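/- Let $\nu>-1$ and $0<\lambda<1$. For $t>0$ put $\rho_\mu(t)=2t^{\mu/2}K_\mu(2\sqrt t)$, where $K_\mu$ is the modified Bessel function (Macdonald function), and $\omega_k=\omega_k(t,\lambda)=\rho_{k+\nu+1}(t)\,\lambda^k/k!$ for $k\in\mathbb N_0$. For each $t>0$ let $(P_n(x)=P_n(x;t,\lambda))_{n\ge0}$ be real polynomials, $P_n$ of degree exactly $n$, that are orthonormal with respect to $\omega_k$: $$\sum_{k=0}^\infty P_n(k;t,\lambda)P_m(k;t,\lambda)\,\omega_k=\delta_{n,m},$$ and let $a_n=a_n(t,\lambda)$ be the leading coefficient of $P_n$. Assume that the sign of each $a_n$ does not depend on $t$ (for example $a_n>0$). Put $P_{-1}\equiv0$, $A_0=0$ and $A_n=a_{n-1}/a_n$ for $n\ge1$. Then for every $n\ge1$ and $t>0$ the coefficients of $P_n$ are differentiable in $t$, and the following hold, all series over $k$ being absolutely convergent. 1. $$\sum_{k=0}^\infty \frac{\partial P_n}{\partial t}(k;t,\lambda)\;k\,P_{n-1}(k-1;t,\lambda)\,\omega_k=\frac{\lambda n}{A_n}-\frac{A_n}{a_n}\frac{\partial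 a_n}{\partial t}.$$ 2. In the expansion $P_n(x+1;t,\lambda)=\sum_{j=0}^n c_{n,j}P_j(x;t,\lambda)$, which exists, the coefficient of $P_{n-1}$ is $$c_{n,n-1}=\sum_{k=0}^\infty P_n(k+1;t,\lambda)P_{n-1}(k;t,\lambda)\,\omega_k=\frac n{A_n}.$$ 3. For every real $x$, with $\Delta P_n(x;t,\lambda)=P_n(x+1;t,\lambda)-P_n(x;t,\lambda)$, $$\Delta P_n(x;t,\lambda)=\frac n{A_n}P_{n-1}(x;t,\lambda)+\frac{A_{n-1}}{\lambda}\sum_{k=0}^\infty\frac{\partial P_n}{\partial t}(k;t,\lambda)\,\frac{k\,\omega_k}{x-k+1}\Big[P_{n-1}(x;t,\lambda)P_{n-2}(k-1;t,\lambda)-P_{n-2}(x;t,\lambda)P_{n-1}(k-1;t,\lambda)\Big],$$ where, if $x=k-1$ for some $k\in\mathbb N_0$, the quotient of the bracket by $x-k+1$ is understood as its limit, i.e. as $P_{n-1}'(x)P_{n-2}(x)-P_{n-2}'(x)P_{n-1}(x)$. -/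

import Mathlib

open Polynomial Set

noncomputable section

namespace MacdonaldPoly

/-- The modified Bessel function of the second kind (Macdonald function) of real order `μ` at a
real argument `z > 0`: `K_μ(z) = (1/2) ∫₀^∞ x^(μ-1) exp(-(z/2) (x + 1/x)) dx`. -/
def macdonaldK (μ z : ℝ) : ℝ :=
  1 / 2 * ∫ x in Ioi (0 : ℝ), x ^ (μ - 1) * Real.exp (-(z / 2) * (x + 1 / x))

/-- `ρ_μ(t) = 2 t^(μ/2) K_μ(2 √t)`, for `t > 0`. -/
def rho (μ t : ℝ) : ℝ :=
  2 * t ^ (μ / 2) * macdonaldK μ (2 * Real.sqrt t)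

/-- The weight `ω_k(t, λ) = ρ_{k+ν+1}(t) λ^k / k!`. -/
def weight (ν lam t : ℝ) (k : ℕ) : ℝ :=
  rho ((k : ℝ) + ν + 1) t * lam ^ k / (k.factorial : ℝ)

/-- The sequence `p` of real polynomials is orthonormal for the weight `ω_k(t, λ)` on `ℕ`,
and `p n` has degree exactly `n`. -/
structure IsOrthonormalSystem (ν lam t : ℝ) (p : ℕ → ℝ[X]) : Prop where
  degree_eq : ∀ n : ℕ, (p n).degree = (n : WithBot ℕ)
  orthonormal : ∀ n m : ℕ,
    HasSum (fun k : ℕ => (p n).eval (k : ℝ) * (p m).eval (k : ℝ) * weight ν lam t k)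
      (if n = m then 1 else 0)

/-- The leading coefficient `a_n(t)` of `P_n(·; t)`. -/
def leadCoeff (P : ℕ → ℝ → ℝ[X]) (n : ℕ) (t : ℝ) : ℝ :=
  (P n t).coeff n

/-- The recurrence coefficient `A_n(t) = a_{n-1}(t) / a_n(t)`, with `A_0 = 0`. -/
def recA (P : ℕ → ℝ → ℝ[X]) : ℕ → ℝ → ℝ
  | 0, _ => 0
  | n + 1, t => leadCoeff P n t / leadCoeff P (n + 1) t

/-- The polynomial preceding `P_n(·; t)`, that is `P_{n-1}(·; t)`, with `P_{-1} = 0`. -/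
def prevPoly (P : ℕ → ℝ → ℝ[X]) : ℕ → ℝ → ℝ[X]
  | 0, _ => 0
  | n + 1, t => P n t

/-- The partial derivative `∂P_n/∂t (x; t)`. -/
def dtP (P : ℕ → ℝ → ℝ[X]) (n : ℕ) (x t : ℝ) : ℝ :=
  deriv (fun s : ℝ => (P n s).eval x) t

/-- The numbers `c j`, `j ≤ n`, are the coefficients of the expansion
`p_n(x + 1) = ∑_{j ≤ n} c_j p_j(x)`. -/
def IsShiftExpansion (p : ℕ → ℝ[X]) (n : ℕ) (c : ℕ → ℝ) : Prop :=
  (p n).comp (X + 1) = ∑ j ∈ Finset.range (n + 1), C (c j) * p j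

/-- The Christoffel-Darboux quotient `(f(x) g(y) - g(x) f(y)) / (x - y)` of two polynomials; on
the diagonal `x = y`, where the quotient has a removable singularity, it is given its limit. -/
def cdQuotient (f g : ℝ[X]) (x y : ℝ) : ℝ :=
  if x = y then f.derivative.eval x * g.eval y - g.derivative.eval x * f.eval y
  else (f.eval x * g.eval y - g.eval x * f.eval y) / (x - y)

/-- The forward difference `Δf(x) = f(x + 1) - f(x)`. -/
def forwardDiff (f : ℝ[X]) (x : ℝ) : ℝ :=
  f.eval (x + 1) - f.eval x

end MacdonaldPoly

end

open MeasureTheory Filter Topology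

/-! ### The function `rho`: integral form, monotonicity, derivative. -/

namespace MacdonaldPoly

/-! Everything rests on ρ_μ' = -ρ_{μ-1}. It gives ∂ω_{k+1}/∂t = -λ ω_k/(k+1), so for the functional
L_t(q) = ∑ q(k) ω_k one has d/dt L_t(x q(x-1)) = -λ L_t(q) (`hasDerivAt_functional_mulXShift`).

Gram–Schmidt shows that the P_n are differentiable in t (`exists_hasCoeffDerivAt`). For j < n, the
quantity L_t(P_n(x) · x P_j(x-1)) is 0 if j < n-1 and A_n if j = n-1, by comparing degrees.
Differentiating it in t, with P_n(x) · x P_j(x-1) read as x r(x-1) for r(x) = P_n(x+1) P_j(x),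
relates L_t(∂_t P_n · x P_j(x-1)) to λ L_t(P_n(x+1) P_j), that is, to the coefficients of ΔP_n. The
case j = n-1 is the first identity, since L_t(P_n(x+1) P_{n-1}) = n/A_n by comparing leading
coefficients. The cases j < n-1 add up to a Christoffel–Darboux kernel, which yields the formula for
ΔP_n. -/

lemma rho_eq_integral (μ : ℝ) {t : ℝ} (ht : 0 < t) :
    rho μ t = ∫ x in Ioi (0 : ℝ), x ^ (μ - 1) * Real.exp (-x - t / x) := by
  have hs : 0 < √t := Real.sqrt_pos.2 ht
  -- The scaling y = √t x turns the symmetric exponent -√t (x + 1/x) into -y - t/y, which is linear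
  -- in t.
  have h := integral_comp_mul_left_Ioi (fun y : ℝ => y ^ (μ - 1) * Real.exp (-y - t / y)) 0 hs
  have h2 : ∫ x in Ioi (0 : ℝ), (√t * x) ^ (μ - 1) * Real.exp (-(√t * x) - t / (√t * x))
      = √t ^ (μ - 1) * ∫ x in Ioi (0 : ℝ),
        x ^ (μ - 1) * Real.exp (-(2 * √t / 2) * (x + 1 / x)) := by
    rw [← integral_const_mul]
    refine setIntegral_congr_fun measurableSet_Ioi fun x hx => ?_
    have hx : 0 < x := hx
    have e : -(√t * x) - t / (√t * x) = -(2 * √t / 2) * (x + 1 / x) := by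
      nth_rw 2 [← Real.mul_self_sqrt ht.le]
      field_simp
      ring
    simp only [e, Real.mul_rpow hs.le hx.le, mul_assoc]
  rw [h2, mul_zero, smul_eq_mul] at h
  have h3 : t ^ (μ / 2) = √t * √t ^ (μ - 1) := by
    rw [Real.rpow_sub_one hs.ne', mul_div_cancel₀ _ hs.ne', Real.sqrt_eq_rpow,
      ← Real.rpow_mul ht.le]
    congr 1; ring
  rw [rho, macdonaldK, h3]
  calc _ = √t * (√t ^ (μ - 1) * ∫ x in Ioi (0 : ℝ),
        x ^ (μ - 1) * Real.exp (-(2 * √t / 2) * (x + 1 / x))) := by ring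
    _ = _ := by rw [h]; field_simp

lemma integrableOn_rpow_mul_exp (μ : ℝ) {t : ℝ} (ht : 0 < t) :
    IntegrableOn (fun x : ℝ => x ^ (μ - 1) * Real.exp (-x - t / x)) (Ioi 0) := by
  -- For μ ≤ 0 the power is not integrable at 0. The bound exp(-t/x) ≤ N! (x/t)^N gains N powers of
  -- x and leaves a Gamma integral of argument μ + N > 0.
  obtain ⟨N, hN⟩ := exists_nat_gt (-μ)
  have hG := (Real.GammaIntegral_convergent (s := μ + N) (by linarith)).const_mul
    ((N.factorial : ℝ) / t ^ N)
  refine Integrable.mono' hG ?_ ?_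
  · refine ContinuousOn.aestronglyMeasurable ?_ measurableSet_Ioi
    intro x hx
    have hx : x ≠ 0 := (ne_of_gt hx)
    refine ContinuousAt.continuousWithinAt ?_
    have h1 : ContinuousAt (fun x : ℝ => x ^ (μ - 1)) x := Real.continuousAt_rpow_const _ _ (Or.inl hx)
    have h2 : ContinuousAt (fun x : ℝ => Real.exp (-x - t / x)) x := by fun_prop (disch := assumption)
    exact h1.mul h2
  · refine (ae_restrict_iff' measurableSet_Ioi).2 (ae_of_all _ fun x hx => ?_)
    have hx : 0 < x := hx
    rw [Real.norm_of_nonneg (by positivity)]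
    have h1 : (t / x) ^ N / N.factorial ≤ Real.exp (t / x) :=
      Real.pow_div_factorial_le_exp _ (by positivity) N
    have h2 : Real.exp (-(t / x)) ≤ N.factorial / t ^ N * x ^ N := by
      rw [Real.exp_neg]
      refine (inv_anti₀ (by positivity) h1).trans_eq ?_
      rw [div_pow]
      field_simp
    have h3 : x ^ (μ + N - 1) = x ^ (μ - 1) * x ^ N := by
      rw [← Real.rpow_natCast, ← Real.rpow_add hx]; congr 1; ring
    rw [sub_eq_add_neg (-x), Real.exp_add, h3]
    calc _ = x ^ (μ - 1) * Real.exp (-x) * Real.exp (-(t / x)) := by ring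
      _ ≤ x ^ (μ - 1) * Real.exp (-x) * (N.factorial / t ^ N * x ^ N) := by gcongr
      _ = _ := by ring

lemma rho_nonneg (μ : ℝ) {t : ℝ} (ht : 0 < t) : 0 ≤ rho μ t := by
  rw [rho_eq_integral μ ht]
  exact setIntegral_nonneg measurableSet_Ioi fun x hx => by
    have hx : 0 < x := hx
    positivity

lemma rho_anti (μ : ℝ) {s t : ℝ} (hs : 0 < s) (hst : s ≤ t) : rho μ t ≤ rho μ s := by
  rw [rho_eq_integral μ hs, rho_eq_integral μ (hs.trans_le hst)]
  refine setIntegral_mono_on (integrableOn_rpow_mul_exp μ (hs.trans_le hst))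
    (integrableOn_rpow_mul_exp μ hs) measurableSet_Ioi fun x hx => ?_
  have hx : 0 < x := hx
  gcongr

/-- Differentiation under the integral: ∂_s brings down -1/x, which lowers the order by one. For s >
t/2 the integrand of order μ - 1 at t/2 dominates. -/
lemma hasDerivAt_rho (μ : ℝ) {t : ℝ} (ht : 0 < t) :
    HasDerivAt (rho μ) (-rho (μ - 1) t) t := by
  have hmem : Ioi (t / 2) ∈ 𝓝 t := Ioi_mem_nhds (by linarith)
  have hmeas (s : ℝ) (hs : s ∈ Ioi (t / 2)) := integrableOn_rpow_mul_exp μ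
    (t := s) (by have : t / 2 < s := hs; linarith)
  have hcongr : (fun s => ∫ x in Ioi (0 : ℝ), x ^ (μ - 1) * Real.exp (-x - s / x)) =ᶠ[𝓝 t] rho μ := by
    filter_upwards [Ioi_mem_nhds ht] with s hs using (rho_eq_integral μ hs).symm
  have key := (hasDerivAt_integral_of_dominated_loc_of_deriv_le
    (μ := volume.restrict (Ioi (0 : ℝ)))
    (F := fun s x : ℝ => x ^ (μ - 1) * Real.exp (-x - s / x))
    (F' := fun s x : ℝ => -(x ^ (μ - 1 - 1) * Real.exp (-x - s / x)))
    (bound := fun x : ℝ => x ^ (μ - 1 - 1) * Real.exp (-x - (t / 2) / x)) (x₀ := t)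
    hmem ?_ (integrableOn_rpow_mul_exp μ ht)
    (integrableOn_rpow_mul_exp (μ - 1) ht).neg.aestronglyMeasurable ?_
    (integrableOn_rpow_mul_exp (μ - 1) (half_pos ht)) ?_).2
  · rw [integral_neg, ← rho_eq_integral (μ - 1) ht] at key
    exact key.congr_of_eventuallyEq hcongr.symm
  · filter_upwards [hmem] with s hs using (hmeas s hs).aestronglyMeasurable
  · refine (ae_restrict_iff' measurableSet_Ioi).2 (ae_of_all _ fun x hx s hs => ?_)
    have hx : 0 < x := hx
    have hs : t / 2 < s := hs
    rw [norm_neg, Real.norm_of_nonneg (by positivity)]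
    gcongr
  · refine (ae_restrict_iff' measurableSet_Ioi).2 (ae_of_all _ fun x hx s hs => ?_)
    have hx : 0 < x := hx
    have h1 : HasDerivAt (fun s : ℝ => -x - s / x) (-(1 / x)) s :=
      ((hasDerivAt_id s).div_const x).const_sub (-x)
    refine (h1.exp.const_mul (x ^ (μ - 1))).congr_deriv ?_
    rw [Real.rpow_sub_one hx.ne' (μ - 1)]
    ring

end MacdonaldPoly

/-! ### Orthonormal polynomials for an abstract functional; Christoffel–Darboux. -/

namespace MacdonaldPoly

/-- The polynomials `p n`, of degree exactly `n`, are orthonormal for the functional `L`. -/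
structure IsOrthonormalFor (L : ℝ[X] →ₗ[ℝ] ℝ) (p : ℕ → ℝ[X]) : Prop where
  degree_eq : ∀ n : ℕ, (p n).degree = (n : WithBot ℕ)
  orthonormal : ∀ n m : ℕ, L (p n * p m) = if n = m then 1 else 0

lemma coeff_ne_zero_of_degree_eq {q : ℝ[X]} {n : ℕ} (h : q.degree = n) : q.coeff n ≠ 0 :=
  coeff_ne_zero_of_eq_degree h

lemma exists_expansion {p : ℕ → ℝ[X]} (hp : ∀ n : ℕ, (p n).degree = (n : WithBot ℕ)) (n : ℕ) :
    ∀ q : ℝ[X], q.degree < (n : WithBot ℕ) → ∃ c : ℕ → ℝ, q = ∑ j ∈ Finset.range n, C (c j) * p j := by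
  induction n with
  | zero =>
    intro q hq
    exact ⟨0, by simpa [Nat.WithBot.lt_zero_iff] using hq⟩
  | succ n ih =>
    intro q hq
    have ha := coeff_ne_zero_of_degree_eq (hp n)
    set b := q.coeff n / (p n).coeff n with hb
    obtain ⟨c, hc⟩ := ih (q - C b * p n) (by
      rw [degree_lt_iff_coeff_zero]
      intro m hm
      rcases hm.eq_or_lt with rfl | hm
      · rw [coeff_sub, coeff_C_mul, hb, div_mul_cancel₀ _ ha, sub_self]
      · rw [coeff_sub, coeff_C_mul, (degree_lt_iff_coeff_zero q (n + 1)).1 hq m hm,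
          coeff_eq_zero_of_degree_lt (n := m) (by rw [hp]; exact_mod_cast hm)]
        simp)
    refine ⟨Function.update c n b, ?_⟩
    rw [Finset.sum_range_succ, Function.update_self, Finset.sum_congr rfl (g := fun j => C (c j) * p j)
      (fun j hj => by rw [Function.update_of_ne (Finset.mem_range.1 hj).ne]), ← hc]
    ring

namespace IsOrthonormalFor

variable {L : ℝ[X] →ₗ[ℝ] ℝ} {p : ℕ → ℝ[X]} (h : IsOrthonormalFor L p)
include h

lemma coeff_ne_zero (n : ℕ) : (p n).coeff n ≠ 0 := coeff_ne_zero_of_degree_eq (h.degree_eq n)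

lemma apply_sum_mul (n j : ℕ) (c : ℕ → ℝ) :
    L ((∑ i ∈ Finset.range n, C (c i) * p i) * p j) = if j < n then c j else 0 := by
  simp [Finset.sum_mul, C_mul', h.orthonormal]

lemma expansion {n : ℕ} {q : ℝ[X]} (hq : q.degree < (n : WithBot ℕ)) :
    q = ∑ j ∈ Finset.range n, C (L (q * p j)) * p j := by
  obtain ⟨c, hc⟩ := exists_expansion h.degree_eq n q hq
  conv_lhs => rw [hc]
  refine Finset.sum_congr rfl fun j hj => ?_
  rw [hc, h.apply_sum_mul, if_pos (Finset.mem_range.1 hj)]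

lemma apply_eq_zero {n : ℕ} {q : ℝ[X]} (hq : q.degree < (n : WithBot ℕ)) : L (p n * q) = 0 := by
  obtain ⟨c, hc⟩ := exists_expansion h.degree_eq n q hq
  rw [mul_comm, hc, h.apply_sum_mul, if_neg (lt_irrefl n)]

/-- The left side is the coefficient of `p n` in the expansion of `q`, and only that term
contributes to `X ^ n`. -/
lemma apply_eq_div {n : ℕ} {q : ℝ[X]} (hq : q.degree < ((n + 1 : ℕ) : WithBot ℕ)) :
    L (p n * q) = q.coeff n / (p n).coeff n := by
  rw [eq_div_iff (h.coeff_ne_zero n)]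
  conv_rhs => rw [h.expansion hq, Finset.sum_range_succ, coeff_add, finsetSum_coeff,
    Finset.sum_eq_zero (fun j hj => by
      rw [coeff_C_mul, coeff_eq_zero_of_degree_lt (n := n)
        (by rw [h.degree_eq]; exact_mod_cast Finset.mem_range.1 hj), mul_zero])]
  rw [coeff_C_mul, zero_add, mul_comm q]

omit h in
lemma degree_lt_of_eq {q : ℝ[X]} {m n : ℕ} (hq : q.degree = m) (hmn : m < n) :
    q.degree < (n : WithBot ℕ) := by rw [hq]; exact_mod_cast hmn

lemma degree_X_mul (m : ℕ) : (X * p m).degree = ((m + 1 : ℕ) : WithBot ℕ) := by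
  rw [degree_mul, degree_X, h.degree_eq, add_comm]; rfl

lemma recurrence_zero :
    X * p 0 = C (L (X * p 0 * p 0)) * p 0 + C ((p 0).coeff 0 / (p 1).coeff 1) * p 1 := by
  have e := h.expansion (n := 2) (degree_lt_of_eq (h.degree_X_mul 0) (by norm_num))
  rw [Finset.sum_range_succ, Finset.sum_range_one, mul_comm (X * p 0) (p 1), h.apply_eq_div
    (degree_lt_of_eq (h.degree_X_mul 0) (by norm_num)), coeff_X_mul] at e
  exact e

lemma recurrence_succ (m : ℕ) :
    X * p (m + 1) = C ((p m).coeff m / (p (m + 1)).coeff (m + 1)) * p m +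
      C (L (X * p (m + 1) * p (m + 1))) * p (m + 1) +
      C ((p (m + 1)).coeff (m + 1) / (p (m + 2)).coeff (m + 2)) * p (m + 2) := by
  have e := h.expansion (n := m + 3) (degree_lt_of_eq (h.degree_X_mul (m + 1)) (by omega))
  have h1 : L (X * p (m + 1) * p m) = (p m).coeff m / (p (m + 1)).coeff (m + 1) := by
    rw [show X * p (m + 1) * p m = p (m + 1) * (X * p m) by ring, h.apply_eq_div
      (degree_lt_of_eq (h.degree_X_mul m) (by omega)), coeff_X_mul]
  have h2 : L (X * p (m + 1) * p (m + 2)) =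
      (p (m + 1)).coeff (m + 1) / (p (m + 2)).coeff (m + 2) := by
    rw [mul_comm, h.apply_eq_div (degree_lt_of_eq (h.degree_X_mul (m + 1)) (by omega)), coeff_X_mul]
  rw [Finset.sum_range_succ, Finset.sum_range_succ, Finset.sum_range_succ, h1, h2,
    Finset.sum_eq_zero, zero_add] at e
  · exact e
  · intro j hj
    rw [show X * p (m + 1) * p j = p (m + 1) * (X * p j) by ring, h.apply_eq_zero
      (degree_lt_of_eq (h.degree_X_mul j) (by have := Finset.mem_range.1 hj; omega))]
    simp

/-- The Christoffel–Darboux formula. -/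
lemma christoffel_darboux (y : ℝ) (m : ℕ) :
    (X - C y) * ∑ j ∈ Finset.range (m + 1), C ((p j).eval y) * p j =
      C ((p m).coeff m / (p (m + 1)).coeff (m + 1)) *
        (C ((p m).eval y) * p (m + 1) - C ((p (m + 1)).eval y) * p m) := by
  induction m with
  | zero =>
    have e := h.recurrence_zero
    have ey := congrArg (fun q => C (eval y q)) e
    simp only [eval_mul, eval_add, eval_X, eval_C, map_mul, map_add] at ey
    rw [Finset.sum_range_one]
    linear_combination C ((p 0).eval y) * e - p 0 * ey
  | succ m ih =>
    have e := h.recurrence_succ m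
    have ey := congrArg (fun q => C (eval y q)) e
    simp only [eval_mul, eval_add, eval_X, eval_C, map_mul, map_add] at ey
    rw [Finset.sum_range_succ, mul_add, ih]
    linear_combination C ((p (m + 1)).eval y) * e - p (m + 1) * ey

lemma cdQuotient_eq (x y : ℝ) (m : ℕ) :
    (p m).coeff m / (p (m + 1)).coeff (m + 1) * cdQuotient (p (m + 1)) (p m) x y =
      ∑ j ∈ Finset.range (m + 1), (p j).eval x * (p j).eval y := by
  have e := h.christoffel_darboux y m
  unfold cdQuotient
  split_ifs with hxy
  · subst hxy
    have e1 := congrArg (fun q => eval x (derivative q)) e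
    simp [eval_finsetSum] at e1
    rw [e1]
    ring
  · have e1 := congrArg (eval x) e
    simp [eval_finsetSum] at e1
    rw [mul_div_assoc', div_eq_iff (sub_ne_zero.2 hxy)]
    simp only [mul_comm (eval x _) (eval y _)] at *
    linear_combination -e1

end IsOrthonormalFor

end MacdonaldPoly

/-! ### Differentiable families of polynomials and functionals. -/

namespace MacdonaldPoly

/-- The polynomials `F s` have bounded degree near `t`, and their coefficients are differentiable
at `t`, with derivatives the coefficients of `F'`. -/
structure HasCoeffDerivAt (F : ℝ → ℝ[X]) (F' : ℝ[X]) (t : ℝ) : Prop where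
  bounded : ∃ N, ∀ᶠ s in 𝓝 t, (F s).natDegree < N
  coeff : ∀ m, HasDerivAt (fun s => (F s).coeff m) (F'.coeff m) t

namespace HasCoeffDerivAt

variable {F G : ℝ → ℝ[X]} {F' G' : ℝ[X]} {t : ℝ}

/-- The degree bound is uniform near `t`, so one fixed finite set of monomials suffices and
differentiation reduces to finite sums. -/
lemma exists_sum (hF : HasCoeffDerivAt F F' t) : ∃ N,
    (∀ᶠ s in 𝓝 t, F s = ∑ i ∈ Finset.range N, (F s).coeff i • X ^ i) ∧
      F' = ∑ i ∈ Finset.range N, F'.coeff i • X ^ i := by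
  obtain ⟨N, hN⟩ := hF.bounded
  refine ⟨max N (F'.natDegree + 1), ?_, ?_⟩
  · filter_upwards [hN] with s hs
    simpa only [smul_eq_C_mul] using as_sum_range_C_mul_X_pow' _ (lt_max_of_lt_left hs)
  · simpa only [smul_eq_C_mul] using as_sum_range_C_mul_X_pow' F' (lt_max_of_lt_right (Nat.lt_succ_self _))

lemma apply {L : ℝ → ℝ[X] →ₗ[ℝ] ℝ} {D : ℝ[X] →ₗ[ℝ] ℝ}
    (hL : ∀ q, HasDerivAt (fun s => L s q) (D q) t) (hF : HasCoeffDerivAt F F' t) :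
    HasDerivAt (fun s => L s (F s)) (L t F' + D (F t)) t := by
  obtain ⟨N, h1, h2⟩ := hF.exists_sum
  have key : HasDerivAt (fun s => ∑ i ∈ Finset.range N, (F s).coeff i * L s (X ^ i))
      (∑ i ∈ Finset.range N, (F'.coeff i * L t (X ^ i) + (F t).coeff i * D (X ^ i))) t :=
    HasDerivAt.fun_sum fun i _ => (hF.coeff i).mul (hL _)
  refine (key.congr_of_eventuallyEq ?_).congr_deriv ?_
  · filter_upwards [h1] with s hs
    conv_lhs => rw [hs]
    simp
  · conv_rhs => rw [h2, h1.self_of_nhds]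
    simp [Finset.sum_add_distrib]

lemma map (T : ℝ[X] →ₗ[ℝ] ℝ[X]) (hF : HasCoeffDerivAt F F' t) :
    HasCoeffDerivAt (fun s => T (F s)) (T F') t where
  bounded := by
    obtain ⟨N, h1, -⟩ := hF.exists_sum
    refine ⟨(Finset.range N).sup (fun i => (T (X ^ i)).natDegree) + 1, ?_⟩
    filter_upwards [h1] with s hs
    rw [hs, map_sum, Nat.lt_succ_iff]
    refine natDegree_sum_le_of_forall_le _ _ fun i hi => ?_
    rw [map_smul]
    exact (natDegree_smul_le _ _).trans (Finset.le_sup (f := fun i => (T (X ^ i)).natDegree) hi)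
  coeff m := by
    have := hF.apply (L := fun _ => (lcoeff ℝ m).comp T) (D := 0) (fun q => hasDerivAt_const _ _)
    simpa using this

lemma mul (hF : HasCoeffDerivAt F F' t) (hG : HasCoeffDerivAt G G' t) :
    HasCoeffDerivAt (fun s => F s * G s) (F' * G t + F t * G') t where
  bounded := by
    obtain ⟨N, hN⟩ := hF.bounded
    obtain ⟨M, hM⟩ := hG.bounded
    refine ⟨N + M, ?_⟩
    filter_upwards [hN, hM] with s h1 h2
    exact natDegree_mul_le.trans_lt (by omega)
  coeff m := by
    have key := HasDerivAt.fun_sum (u := Finset.HasAntidiagonal.antidiagonal m) (x := t) fun i _ =>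
      (hF.coeff i.1).fun_mul (hG.coeff i.2)
    simpa only [coeff_add, coeff_mul, Finset.sum_add_distrib] using key

lemma sub (hF : HasCoeffDerivAt F F' t) (hG : HasCoeffDerivAt G G' t) :
    HasCoeffDerivAt (fun s => F s - G s) (F' - G') t where
  bounded := by
    obtain ⟨N, hN⟩ := hF.bounded
    obtain ⟨M, hM⟩ := hG.bounded
    refine ⟨max N M, ?_⟩
    filter_upwards [hN, hM] with s h1 h2
    exact (natDegree_sub_le _ _).trans_lt (max_lt_max h1 h2)
  coeff m := by simpa only [coeff_sub] using (hF.coeff m).fun_sub (hG.coeff m)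

lemma sum {ι : Type*} (S : Finset ι) {F : ι → ℝ → ℝ[X]} {F' : ι → ℝ[X]}
    (hF : ∀ i ∈ S, HasCoeffDerivAt (F i) (F' i) t) :
    HasCoeffDerivAt (fun s => ∑ i ∈ S, F i s) (∑ i ∈ S, F' i) t where
  bounded := by
    choose! N hN using fun i hi => (hF i hi).bounded
    refine ⟨S.sup N + 1, ?_⟩
    filter_upwards [(Finset.eventually_all S).2 hN] with s hs
    rw [Nat.lt_succ_iff]
    exact natDegree_sum_le_of_forall_le _ _ fun i hi => (hs i hi).le.trans (Finset.le_sup hi)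
  coeff m := by
    simpa only [finsetSum_coeff] using HasDerivAt.fun_sum fun i hi => (hF i hi).coeff m

lemma const (q : ℝ[X]) (t : ℝ) : HasCoeffDerivAt (fun _ => q) 0 t where
  bounded := ⟨q.natDegree + 1, .of_forall fun _ => Nat.lt_succ_self _⟩
  coeff m := by simpa using hasDerivAt_const t (q.coeff m)

lemma C_mul {f : ℝ → ℝ} {f' : ℝ} (hf : HasDerivAt f f' t) (hF : HasCoeffDerivAt F F' t) :
    HasCoeffDerivAt (fun s => C (f s) * F s) (C f' * F t + C (f t) * F') t := by
  refine mul ⟨⟨1, .of_forall fun s => by simp⟩, fun m => ?_⟩ hF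
  rcases m with _ | m
  · simpa using hf
  · simpa [coeff_C_succ] using hasDerivAt_const t (0 : ℝ)

lemma congr_of_eventuallyEq (hF : HasCoeffDerivAt F F' t) (h : G =ᶠ[𝓝 t] F) :
    HasCoeffDerivAt G F' t where
  bounded := by
    obtain ⟨N, hN⟩ := hF.bounded
    refine ⟨N, ?_⟩
    filter_upwards [hN, h] with s hs h using h ▸ hs
  coeff m := (hF.coeff m).congr_of_eventuallyEq (h.fun_comp fun q => q.coeff m)

lemma eval (hF : HasCoeffDerivAt F F' t) (x : ℝ) :
    HasDerivAt (fun s => (F s).eval x) (F'.eval x) t := by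
  have := hF.apply (L := fun _ => leval x) (D := 0) (fun q => hasDerivAt_const _ _)
  simpa using this

lemma degree_lt {n : ℕ} (hF : HasCoeffDerivAt F F' t)
    (h : ∀ᶠ s in 𝓝 t, (F s).degree < (n : WithBot ℕ)) : F'.degree < (n : WithBot ℕ) := by
  rw [degree_lt_iff_coeff_zero]
  intro m hm
  refine (hF.coeff m).unique ((hasDerivAt_const t (0 : ℝ)).congr_of_eventuallyEq ?_)
  filter_upwards [h] with s hs using (degree_lt_iff_coeff_zero _ _).1 hs m hm

end HasCoeffDerivAt

/-- The pointwise derivative of a differentiable family of linear functionals is linear. -/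
lemma exists_linear_deriv {L : ℝ → ℝ[X] →ₗ[ℝ] ℝ} {t : ℝ}
    (hL : ∀ q, DifferentiableAt ℝ (fun s => L s q) t) :
    ∃ D : ℝ[X] →ₗ[ℝ] ℝ, ∀ q, HasDerivAt (fun s => L s q) (D q) t :=
  ⟨{ toFun := fun q => deriv (fun s => L s q) t
     map_add' := fun p q => by simp only [map_add]; exact deriv_fun_add (hL p) (hL q)
     map_smul' := fun c q => by
      simp only [map_smul, smul_eq_mul, RingHom.id_apply]; exact deriv_const_mul c (hL q) },
    fun q => (hL q).hasDerivAt⟩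

/-- Orthonormal polynomials with leading coefficients of constant sign inherit differentiability
from the functional. -/
lemma exists_hasCoeffDerivAt {L : ℝ → ℝ[X] →ₗ[ℝ] ℝ} {P : ℕ → ℝ → ℝ[X]} {t : ℝ}
    (hL : ∀ q, DifferentiableAt ℝ (fun s => L s q) t)
    (hP : ∀ᶠ s in 𝓝 t, IsOrthonormalFor (L s) (fun n => P n s))
    (hsign : ∀ n, ∀ᶠ s in 𝓝 t, 0 < (P n s).coeff n * (P n t).coeff n) (n : ℕ) :
    ∃ F', HasCoeffDerivAt (P n) F' t := by
  obtain ⟨D, hD⟩ := exists_linear_deriv hL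
  induction n using Nat.strong_induction_on with
  | _ n ih =>
  choose! Q hQ using ih
  -- The monic orthogonal polynomial by Gram–Schmidt. It involves only the `P j` with `j < n`, so it
  -- is differentiable by induction.
  set M : ℝ → ℝ[X] := fun s => X ^ n - ∑ j ∈ Finset.range n, C (L s (X ^ n * P j s)) * P j s with hM
  have hMd := (HasCoeffDerivAt.const (X ^ n) t).sub (HasCoeffDerivAt.sum (Finset.range n)
    fun j hj => HasCoeffDerivAt.C_mul
      (((HasCoeffDerivAt.const (X ^ n) t).mul (hQ j (Finset.mem_range.1 hj))).apply hD)
      (hQ j (Finset.mem_range.1 hj)))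
  have hN := (hMd.mul hMd).apply hD
  have hPM : ∀ᶠ s in 𝓝 t, M s = C ((P n s).coeff n)⁻¹ * P n s := by
    filter_upwards [hP] with s hs
    have hdeg : ((X : ℝ[X]) ^ n).degree < ((n + 1 : ℕ) : WithBot ℕ) :=
      IsOrthonormalFor.degree_lt_of_eq (degree_X_pow n) (Nat.lt_succ_self n)
    have e := hs.expansion hdeg
    rw [Finset.sum_range_succ, mul_comm (X ^ n) (P n s), hs.apply_eq_div hdeg, coeff_X_pow_self,
      one_div] at e
    rw [hM]
    linear_combination e
  have hsq : ∀ᶠ s in 𝓝 t, L s (M s * M s) = ((P n s).coeff n ^ 2)⁻¹ := by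
    filter_upwards [hPM, hP] with s hs h
    rw [hs, show C ((P n s).coeff n)⁻¹ * P n s * (C ((P n s).coeff n)⁻¹ * P n s) =
      (((P n s).coeff n)⁻¹ * ((P n s).coeff n)⁻¹) • (P n s * P n s) by
        rw [smul_eq_C_mul, map_mul]; ring, map_smul, h.orthonormal, if_pos rfl]
    simp [sq]
  have hne : (P n t).coeff n ≠ 0 := hP.self_of_nhds.coeff_ne_zero n
  -- Since L(M²) = a_n⁻², the modulus of a_n is differentiable; the constant sign selects the branch
  -- of the square root.
  have ha : DifferentiableAt ℝ (fun s => (P n s).coeff n) t := by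
    have hpos : L t (M t * M t) ≠ 0 := by rw [hsq.self_of_nhds]; positivity
    have h1 : DifferentiableAt ℝ (fun s => |(P n t).coeff n|⁻¹ * (P n t).coeff n *
        √(L s (M s * M s))⁻¹) t :=
      ((hN.differentiableAt.fun_inv hpos).sqrt (inv_ne_zero hpos)).const_mul _
    refine h1.congr_of_eventuallyEq ?_
    filter_upwards [hsq, hsign n] with s hs hsg
    rw [hs, inv_inv, Real.sqrt_sq_eq_abs]
    rcases pos_and_pos_or_neg_and_neg_of_mul_pos hsg with ⟨h1, h2⟩ | ⟨h1, h2⟩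
    · rw [abs_of_pos h1, abs_of_pos h2]; field_simp
    · rw [abs_of_neg h1, abs_of_neg h2]; field_simp
  refine ⟨_, (HasCoeffDerivAt.C_mul ha.hasDerivAt hMd).congr_of_eventuallyEq ?_⟩
  filter_upwards [hPM, hP] with s hs h
  change P n s = C ((P n s).coeff n) * M s
  rw [hs, ← mul_assoc, ← C_mul, mul_inv_cancel₀ (h.coeff_ne_zero n), C_1, one_mul]

end MacdonaldPoly

/-! ### The shift operator and the differentiated orthogonality relations. -/

namespace MacdonaldPoly

/-- The operator `q ↦ x q(x - 1)`. -/
noncomputable def mulXShift : ℝ[X] →ₗ[ℝ] ℝ[X] := (LinearMap.mulLeft ℝ X).comp (taylor (-1))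

lemma mulXShift_apply (q : ℝ[X]) : mulXShift q = X * taylor (-1) q := rfl

lemma eval_mulXShift (q : ℝ[X]) (x : ℝ) : (mulXShift q).eval x = x * q.eval (x - 1) := by
  rw [mulXShift_apply, eval_mul, eval_X, taylor_eval, sub_eq_add_neg]

/-- Translation is multiplicative. This form lets the derivative rule for L(x q(x-1)) produce
p(x+1). -/
lemma mul_mulXShift (p q : ℝ[X]) : p * mulXShift q = mulXShift (taylor 1 p * q) := by
  rw [mulXShift_apply, mulXShift_apply, taylor_mul, taylor_taylor]
  simp
  ring

lemma degree_mulXShift_lt {q : ℝ[X]} {n : ℕ} (hq : q.degree < (n : WithBot ℕ)) :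
    (mulXShift q).degree < ((n + 1 : ℕ) : WithBot ℕ) := by
  rw [degree_lt_iff_coeff_zero]
  rintro (_ | m) hm
  · omega
  · rw [mulXShift_apply, coeff_X_mul]
    exact coeff_eq_zero_of_degree_lt
      ((degree_taylor q (-1)).trans_lt (hq.trans_le (by exact_mod_cast (by omega : n ≤ m))))

lemma coeff_taylor_of_degree_lt {q : ℝ[X]} {n : ℕ} (r : ℝ)
    (hq : q.degree < ((n + 1 : ℕ) : WithBot ℕ)) : (taylor r q).coeff n = q.coeff n := by
  have h : q.natDegree ≤ n := by
    rw [natDegree_le_iff_coeff_eq_zero]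
    exact fun m hm => (degree_lt_iff_coeff_zero _ _).1 hq m hm
  rcases h.lt_or_eq with h | rfl
  · rw [coeff_eq_zero_of_natDegree_lt h, coeff_eq_zero_of_natDegree_lt (by rwa [natDegree_taylor])]
  · rw [coeff_taylor_natDegree, leadingCoeff]

lemma coeff_mulXShift {q : ℝ[X]} {n : ℕ} (hq : q.degree < ((n + 1 : ℕ) : WithBot ℕ)) :
    (mulXShift q).coeff (n + 1) = q.coeff n := by
  rw [mulXShift_apply, coeff_X_mul, coeff_taylor_of_degree_lt _ hq]

lemma coeff_taylor_one {q : ℝ[X]} {n : ℕ} (hq : q.degree < ((n + 2 : ℕ) : WithBot ℕ)) :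
    (taylor 1 q).coeff n = q.coeff n + (n + 1) * q.coeff (n + 1) := by
  have hd : (hasseDeriv n q).natDegree < 2 := by
    refine (natDegree_hasseDeriv_le q n).trans_lt ?_
    have : q.natDegree ≤ n + 1 := by
      rw [natDegree_le_iff_coeff_eq_zero]
      exact fun m hm => (degree_lt_iff_coeff_zero _ _).1 hq m hm
    omega
  rw [taylor_coeff, eval_eq_sum_range' hd, Finset.sum_range_succ, Finset.sum_range_one,
    hasseDeriv_coeff, hasseDeriv_coeff, add_comm 1 n, Nat.choose_succ_self_right]
  simp

lemma degree_taylor_sub_lt {q : ℝ[X]} {n : ℕ} (hq : q.degree < ((n + 1 : ℕ) : WithBot ℕ)) (r : ℝ) :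
    (taylor r q - q).degree < (n : WithBot ℕ) := by
  rw [degree_lt_iff_coeff_zero]
  intro m hm
  rw [coeff_sub, coeff_taylor_of_degree_lt r
    (hq.trans_le (by exact_mod_cast (by omega : n + 1 ≤ m + 1))), sub_self]

namespace IsOrthonormalFor

variable {L : ℝ[X] →ₗ[ℝ] ℝ} {p : ℕ → ℝ[X]} (h : IsOrthonormalFor L p)
include h

lemma degree_lt {m n : ℕ} (hmn : m < n) : (p m).degree < (n : WithBot ℕ) :=
  degree_lt_of_eq (h.degree_eq m) hmn

/-- Subtracting `p n` changes nothing by orthogonality, but it lowers the degree. -/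
lemma apply_taylor_mul {j n : ℕ} (hj : j ≠ n) (r : ℝ) :
    L (taylor r (p n) * p j) = L ((taylor r (p n) - p n) * p j) := by
  rw [sub_mul, map_sub, h.orthonormal, if_neg hj.symm, sub_zero]

lemma apply_taylor_one_mul (m : ℕ) :
    L (taylor 1 (p (m + 1)) * p m) = (m + 1) / ((p m).coeff m / (p (m + 1)).coeff (m + 1)) := by
  have hd := h.degree_lt (Nat.lt_succ_self (m + 1))
  rw [h.apply_taylor_mul (by omega), mul_comm, h.apply_eq_div (degree_taylor_sub_lt hd 1),
    coeff_sub, coeff_taylor_one hd, add_sub_cancel_left]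
  have := h.coeff_ne_zero m
  have := h.coeff_ne_zero (m + 1)
  field_simp

lemma taylor_sub_eq (r : ℝ) (n : ℕ) :
    taylor r (p n) - p n = ∑ j ∈ Finset.range n, C (L (taylor r (p n) * p j)) * p j := by
  conv_lhs => rw [h.expansion (degree_taylor_sub_lt (h.degree_lt (Nat.lt_succ_self n)) r)]
  refine Finset.sum_congr rfl fun j hj => ?_
  rw [h.apply_taylor_mul (Finset.mem_range.1 hj).ne]

end IsOrthonormalFor

section Family

variable {L : ℝ → ℝ[X] →ₗ[ℝ] ℝ} {P : ℕ → ℝ → ℝ[X]} {Q : ℕ → ℝ[X]} {t lam : ℝ}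
  (hL : ∀ q, DifferentiableAt ℝ (fun s => L s q) t)
  (hLX : ∀ q, HasDerivAt (fun s => L s (mulXShift q)) (-lam * L t q) t)
  (hQ : ∀ n, HasCoeffDerivAt (P n) (Q n) t)
  (hP : ∀ᶠ s in 𝓝 t, IsOrthonormalFor (L s) (fun n => P n s))
include hL hLX hQ

lemma hasDerivAt_apply_mul_mulXShift (n j : ℕ) :
    HasDerivAt (fun s => L s (P n s * mulXShift (P j s)))
      (L t (Q n * mulXShift (P j t)) + L t (P n t * mulXShift (Q j)) -
        lam * L t (taylor 1 (P n t) * P j t)) t := by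
  obtain ⟨D, hD⟩ := exists_linear_deriv hL
  refine (((hQ n).mul ((hQ j).map mulXShift)).apply hD).congr_deriv ?_
  rw [map_add, mul_mulXShift (P n t) (P j t), (hD _).unique (hLX _)]
  ring

include hP

/-- Here x P_j(x-1) has degree at most n, so its pairing with P_{n+1} vanishes near `t`; the same
holds at `t` with ∂_t P_j in place of P_j. -/
lemma apply_deriv_mul_mulXShift_of_lt {n j : ℕ} (hj : j < n) :
    L t (Q (n + 1) * mulXShift (P j t)) = lam * L t (taylor 1 (P (n + 1) t) * P j t) := by
  have h1 := hasDerivAt_apply_mul_mulXShift hL hLX hQ (n + 1) j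
  have h2 := h1.unique ((hasDerivAt_const t (0 : ℝ)).congr_of_eventuallyEq (by
    filter_upwards [hP] with s hs
    exact hs.apply_eq_zero (degree_mulXShift_lt (hs.degree_lt hj))))
  rw [hP.self_of_nhds.apply_eq_zero (n := n + 1) (degree_mulXShift_lt
    ((hQ j).degree_lt (hP.mono fun s hs => hs.degree_lt hj)))] at h2
  linear_combination h2

/-- The differentiated pairing is now a_n/a_{n+1}. The term a_n'/a_{n+1} of the quotient rule
cancels against the term containing ∂_t P_n. -/
lemma apply_deriv_mul_mulXShift (n : ℕ) :
    L t (Q (n + 1) * mulXShift (P n t)) =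
      lam * (n + 1) / ((P n t).coeff n / (P (n + 1) t).coeff (n + 1)) -
        (P n t).coeff n / (P (n + 1) t).coeff (n + 1) / (P (n + 1) t).coeff (n + 1) *
          (Q (n + 1)).coeff (n + 1) := by
  have hPt := hP.self_of_nhds
  have hne := hPt.coeff_ne_zero n
  have hne' := hPt.coeff_ne_zero (n + 1)
  have h1 := hasDerivAt_apply_mul_mulXShift hL hLX hQ (n + 1) n
  have h2 := h1.unique ((((hQ n).coeff n).fun_div ((hQ (n + 1)).coeff (n + 1)) hne')
    |>.congr_of_eventuallyEq (by
      filter_upwards [hP] with s hs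
      have hd := hs.degree_lt (Nat.lt_succ_self n)
      rw [hs.apply_eq_div (n := n + 1) (degree_mulXShift_lt hd), coeff_mulXShift hd]))
  have hd := (hQ n).degree_lt (hP.mono fun s hs => hs.degree_lt (Nat.lt_succ_self n))
  rw [hPt.apply_taylor_one_mul, hPt.apply_eq_div (n := n + 1) (degree_mulXShift_lt hd),
    coeff_mulXShift hd] at h2
  have e : L t (Q (n + 1) * mulXShift (P n t)) = _ + _ - _ :=
    eq_sub_of_add_eq (eq_add_of_sub_eq h2)
  rw [e]
  field_simp
  ring

lemma taylor_sub_eq_deriv (hlam : lam ≠ 0) (n : ℕ) (x : ℝ) :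
    (P (n + 1) t).eval (x + 1) - (P (n + 1) t).eval x =
      (n + 1) / ((P n t).coeff n / (P (n + 1) t).coeff (n + 1)) * (P n t).eval x +
        lam⁻¹ * L t (Q (n + 1) *
          mulXShift (∑ j ∈ Finset.range n, C ((P j t).eval x) * P j t)) := by
  have hPt := hP.self_of_nhds
  have e := congrArg (eval x) (hPt.taylor_sub_eq 1 (n + 1))
  rw [Finset.sum_range_succ, hPt.apply_taylor_one_mul, eval_sub, taylor_eval] at e
  rw [e]
  simp only [← smul_eq_C_mul, eval_add, eval_finsetSum, eval_smul, smul_eq_mul, map_sum,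
    Finset.mul_sum, map_smul, mul_smul_comm]
  rw [add_comm, add_right_inj]
  refine Finset.sum_congr rfl fun j hj => ?_
  rw [apply_deriv_mul_mulXShift_of_lt hL hLX hQ hP (Finset.mem_range.1 hj)]
  field_simp

end Family

end MacdonaldPoly

/-! ### The functional defined by the weight, and the main theorem. -/

namespace MacdonaldPoly

section Weight

variable {ν lam t : ℝ}

lemma weight_nonneg (ν : ℝ) (hlam : 0 < lam) (ht : 0 < t) (k : ℕ) : 0 ≤ weight ν lam t k := by
  have := rho_nonneg ((k : ℝ) + ν + 1) ht
  unfold weight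
  positivity

lemma weight_anti (ν : ℝ) (hlam : 0 < lam) {s : ℝ} (hs : 0 < s) (hst : s ≤ t) (k : ℕ) :
    weight ν lam t k ≤ weight ν lam s k := by
  have := rho_anti ((k : ℝ) + ν + 1) hs hst
  unfold weight
  gcongr

lemma hasDerivAt_weight_zero (ν lam : ℝ) (ht : 0 < t) :
    HasDerivAt (fun s => weight ν lam s 0) (-rho ν t) t := by
  have h := hasDerivAt_rho (ν + 1) ht
  simpa [weight] using h

lemma hasDerivAt_weight_succ (ν lam : ℝ) (ht : 0 < t) (k : ℕ) :
    HasDerivAt (fun s => weight ν lam s (k + 1)) (-lam / (k + 1) * weight ν lam t k) t := by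
  have h := ((hasDerivAt_rho (((k + 1 : ℕ) : ℝ) + ν + 1) ht).mul_const (lam ^ (k + 1))).div_const
    ((k + 1).factorial : ℝ)
  refine h.congr_deriv ?_
  have e : ((k + 1 : ℕ) : ℝ) + ν + 1 - 1 = (k : ℝ) + ν + 1 := by push_cast; ring
  rw [e, weight, Nat.factorial_succ]
  push_cast
  field_simp
  ring

/-- Weights decrease in s, so on s > t/2 the differentiated terms are dominated by their absolute
values at t/2. -/
lemma hasDerivAt_tsum_weight_succ (hlam : 0 < lam) (ht : 0 < t) {g : ℕ → ℝ}
    (h0 : Summable fun k : ℕ => g k * weight ν lam t (k + 1))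
    (h1 : Summable fun k : ℕ => g k / (k + 1) * weight ν lam (t / 2) k) :
    HasDerivAt (fun s => ∑' k : ℕ, g k * weight ν lam s (k + 1))
      (∑' k : ℕ, -lam * (g k / (k + 1) * weight ν lam t k)) t := by
  have ht2 : t / 2 < t := by linarith
  refine hasDerivAt_tsum_of_isPreconnected (h1.abs.mul_left lam) isOpen_Ioi
    (convex_Ioi (t / 2)).isPreconnected
    (g' := fun k s => -lam * (g k / (k + 1) * weight ν lam s k)) (fun k s hs => ?_)
    (fun k s hs => ?_) ht2 h0 ht2
  · have hs : t / 2 < s := hs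
    refine ((hasDerivAt_weight_succ ν lam (by linarith : 0 < s) k).const_mul (g k)).congr_deriv ?_
    ring
  · have hs : t / 2 < s := hs
    rw [norm_mul, norm_neg, Real.norm_of_nonneg hlam.le, Real.norm_eq_abs, abs_mul, abs_mul,
      abs_of_nonneg (weight_nonneg ν hlam (by linarith) k),
      abs_of_nonneg (weight_nonneg ν hlam (by linarith) k)]
    gcongr
    exact weight_anti ν hlam (by linarith) hs.le k

/-- Since `p 0` is a nonzero constant, the series pairing `p j` with `p 0` already give the
summability of each `p j`. -/
lemma IsOrthonormalSystem.summable {p : ℕ → ℝ[X]} (h : IsOrthonormalSystem ν lam t p) (q : ℝ[X]) :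
    Summable fun k : ℕ => q.eval (k : ℝ) * weight ν lam t k := by
  have hc : p 0 = C ((p 0).coeff 0) := eq_C_of_degree_le_zero (h.degree_eq 0).le
  have hne : (p 0).coeff 0 ≠ 0 := coeff_ne_zero_of_degree_eq (h.degree_eq 0)
  obtain ⟨c, hq⟩ := exists_expansion h.degree_eq (q.natDegree + 1) q
    (degree_le_natDegree.trans_lt (by exact_mod_cast Nat.lt_succ_self _))
  rw [hq]
  simp only [eval_finsetSum, Finset.sum_mul]
  refine summable_sum fun j _ => ?_
  refine ((h.orthonormal j 0).summable.mul_left (c j / (p 0).coeff 0)).congr fun k => ?_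
  rw [hc, eval_C, eval_mul, eval_C, coeff_C_zero]
  field_simp

/-- A family of functionals given by summation against the weight. -/
lemma exists_functional (hS : ∀ s : ℝ, 0 < s → ∀ q : ℝ[X],
      Summable fun k : ℕ => q.eval (k : ℝ) * weight ν lam s k) :
    ∃ L : ℝ → ℝ[X] →ₗ[ℝ] ℝ, ∀ s : ℝ, 0 < s → ∀ q : ℝ[X],
      HasSum (fun k : ℕ => q.eval (k : ℝ) * weight ν lam s k) (L s q) := by
  have (s : ℝ) : ∃ l : ℝ[X] →ₗ[ℝ] ℝ, 0 < s → ∀ q : ℝ[X],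
      HasSum (fun k : ℕ => q.eval (k : ℝ) * weight ν lam s k) (l q) := by
    by_cases hs : 0 < s
    · refine ⟨{ toFun := fun q => ∑' k : ℕ, q.eval (k : ℝ) * weight ν lam s k
                map_add' := fun p q => ?_
                map_smul' := fun c q => ?_ }, fun _ q => (hS s hs q).hasSum⟩
      · simp only [eval_add, add_mul]
        exact (hS s hs p).tsum_add (hS s hs q)
      · simp only [eval_smul, smul_eq_mul, mul_assoc, RingHom.id_apply]
        exact tsum_mul_left
    · exact ⟨0, fun h => absurd h hs⟩
  choose L hL using this
  exact ⟨L, hL⟩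

variable {L : ℝ → ℝ[X] →ₗ[ℝ] ℝ}
  (hL : ∀ s : ℝ, 0 < s → ∀ q : ℝ[X],
    HasSum (fun k : ℕ => q.eval (k : ℝ) * weight ν lam s k) (L s q))
include hL

lemma hasSum_weight_succ {s : ℝ} (hs : 0 < s) (q : ℝ[X]) :
    HasSum (fun k : ℕ => q.eval ((k : ℝ) + 1) * weight ν lam s (k + 1))
      (L s q - q.eval 0 * weight ν lam s 0) := by
  simpa using (hasSum_nat_add_iff' 1).2 (hL s hs q)

lemma hasDerivAt_functional_mulXShift (hlam : 0 < lam) (ht : 0 < t) (q : ℝ[X]) :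
    HasDerivAt (fun s => L s (mulXShift q)) (-lam * L t q) t := by
  have h {s : ℝ} (hs : 0 < s) : HasSum (fun k : ℕ => ((k + 1) * q.eval (k : ℝ)) *
      weight ν lam s (k + 1)) (L s (mulXShift q)) := by
    simpa [eval_mulXShift] using hasSum_weight_succ hL hs (mulXShift q)
  have e (k : ℕ) : ((k : ℝ) + 1) * q.eval (k : ℝ) / (k + 1) = q.eval (k : ℝ) := by field_simp
  have key := hasDerivAt_tsum_weight_succ hlam ht (h ht).summable
    (by simpa only [e] using (hL (t / 2) (half_pos ht) q).summable)
  simp only [e, ((hL t ht q).mul_left (-lam)).tsum_eq] at key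
  refine key.congr_of_eventuallyEq ?_
  filter_upwards [Ioi_mem_nhds ht] with s hs using (h hs).tsum_eq.symm

lemma differentiableAt_functional (hlam : 0 < lam) (ht : 0 < t) (q : ℝ[X]) :
    DifferentiableAt ℝ (fun s => L s q) t := by
  have h1 : DifferentiableAt ℝ (fun s => L s 1) t := by
    have h {s : ℝ} (hs : 0 < s) : HasSum (fun k : ℕ => 1 * weight ν lam s (k + 1))
        (L s 1 - weight ν lam s 0) := by
      simpa using hasSum_weight_succ hL hs 1
    have hs : Summable fun k : ℕ => (1 : ℝ) / (k + 1) * weight ν lam (t / 2) k := by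
      refine Summable.of_nonneg_of_le (fun k => ?_) (fun k => ?_) (hL (t / 2) (half_pos ht) 1).summable
      · have := weight_nonneg ν hlam (half_pos ht) k
        positivity
      · rw [eval_one]
        refine mul_le_mul_of_nonneg_right ?_ (weight_nonneg ν hlam (half_pos ht) k)
        rw [div_le_one (by positivity)]
        linarith [k.cast_nonneg (α := ℝ)]
    refine ((hasDerivAt_tsum_weight_succ hlam ht (h ht).summable hs).differentiableAt.fun_add
      (hasDerivAt_weight_zero ν lam ht).differentiableAt).congr_of_eventuallyEq ?_
    filter_upwards [Ioi_mem_nhds ht] with s hs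
    rw [(h hs).tsum_eq, sub_add_cancel]
  -- Polynomials vanishing at 0 are exactly the range of `mulXShift`; only constants need the
  -- separate argument, where ω_0' = -ρ_ν leaves the family of weights.
  have e : q = mulXShift (taylor 1 q.divX) + q.coeff 0 • 1 := by
    conv_lhs => rw [← divX_mul_X_add q]
    rw [mulXShift_apply, taylor_taylor, smul_eq_C_mul, mul_comm X]
    simp
  rw [e]
  simp only [map_add, map_smul, smul_eq_mul]
  exact (hasDerivAt_functional_mulXShift hL hlam ht _).differentiableAt.fun_add (h1.const_mul _)

lemma IsOrthonormalSystem.isOrthonormalFor (ht : 0 < t) {p : ℕ → ℝ[X]}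
    (h : IsOrthonormalSystem ν lam t p) : IsOrthonormalFor (L t) p where
  degree_eq := h.degree_eq
  orthonormal n m := by
    refine (hL t ht (p n * p m)).unique ?_
    simpa only [eval_mul] using h.orthonormal n m

end Weight

lemma comp_X_add_one (q : ℝ[X]) : q.comp (X + 1) = taylor 1 q := by
  rw [taylor_apply, C_1]

/-- The Christoffel–Darboux formula, including the diagonal and the empty sum. -/
lemma recA_mul_cdQuotient {L : ℝ[X] →ₗ[ℝ] ℝ} {P : ℕ → ℝ → ℝ[X]} {t : ℝ}
    (h : IsOrthonormalFor L (fun n => P n t)) (n : ℕ) (x y : ℝ) :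
    recA P n t * cdQuotient (P n t) (prevPoly P n t) x y =
      ∑ j ∈ Finset.range n, (P j t).eval x * (P j t).eval y := by
  cases n with
  | zero => simp [recA]
  | succ n => exact h.cdQuotient_eq x y n

end MacdonaldPoly

theorem corollary2 (ν lam : ℝ) (hν : -1 < ν) (hlam0 : 0 < lam) (hlam1 : lam < 1)
    (P : ℕ → ℝ → ℝ[X])
    (hP : ∀ t : ℝ, 0 < t → MacdonaldPoly.IsOrthonormalSystem ν lam t (fun n => P n t))
    (hsign : ∀ n : ℕ, ∀ s t : ℝ, 0 < s → 0 < t →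
      0 < MacdonaldPoly.leadCoeff P n s * MacdonaldPoly.leadCoeff P n t)
    (n : ℕ) (hn : 1 ≤ n) (t : ℝ) (ht : 0 < t) :
    -- the coefficients of `P_n` are differentiable in `t`
    (∀ m : ℕ, DifferentiableAt ℝ (fun s : ℝ => (P n s).coeff m) t) ∧
    -- the summation identity
    HasSum (fun k : ℕ => MacdonaldPoly.dtP P n (k : ℝ) t *
        ((k : ℝ) * (P (n - 1) t).eval ((k : ℝ) - 1)) * MacdonaldPoly.weight ν lam t k)
      (lam * (n : ℝ) / MacdonaldPoly.recA P n t -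
        MacdonaldPoly.recA P n t / MacdonaldPoly.leadCoeff P n t *
          deriv (fun s : ℝ => MacdonaldPoly.leadCoeff P n s) t) ∧
    -- the value of the expansion coefficient `c_{n,n-1}`
    (∃ c : ℕ → ℝ, MacdonaldPoly.IsShiftExpansion (fun j => P j t) n c) ∧
    (∀ c : ℕ → ℝ, MacdonaldPoly.IsShiftExpansion (fun j => P j t) n c →
      c (n - 1) = (n : ℝ) / MacdonaldPoly.recA P n t) ∧
    HasSum (fun k : ℕ => (P n t).eval ((k : ℝ) + 1) * (P (n - 1) t).eval (k : ℝ) *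
        MacdonaldPoly.weight ν lam t k)
      ((n : ℝ) / MacdonaldPoly.recA P n t) ∧
    -- the formula for the forward difference
    (∀ x : ℝ,
      Summable (fun k : ℕ => MacdonaldPoly.dtP P n (k : ℝ) t *
        ((k : ℝ) * MacdonaldPoly.weight ν lam t k) *
        MacdonaldPoly.cdQuotient (P (n - 1) t) (MacdonaldPoly.prevPoly P (n - 1) t)
          x ((k : ℝ) - 1)) ∧
      MacdonaldPoly.forwardDiff (P n t) x =
        (n : ℝ) / MacdonaldPoly.recA P n t * (P (n - 1) t).eval x +
        MacdonaldPoly.recA P (n - 1) t / lam *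
          ∑' k : ℕ, MacdonaldPoly.dtP P n (k : ℝ) t *
            ((k : ℝ) * MacdonaldPoly.weight ν lam t k) *
            MacdonaldPoly.cdQuotient (P (n - 1) t) (MacdonaldPoly.prevPoly P (n - 1) t)
              x ((k : ℝ) - 1)) := by
  open MacdonaldPoly in
  obtain ⟨L, hL⟩ := exists_functional fun s hs => (hP s hs).summable
  have hpos : ∀ᶠ s : ℝ in 𝓝 t, 0 < s := Ioi_mem_nhds ht
  have hPL : ∀ᶠ s in 𝓝 t, IsOrthonormalFor (L s) (fun n => P n s) :=
    hpos.mono fun s hs => (hP s hs).isOrthonormalFor hL hs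
  have hPt := hPL.self_of_nhds
  have hLd := differentiableAt_functional hL hlam0 ht
  have hLX := hasDerivAt_functional_mulXShift hL hlam0 ht
  choose Q hQ using exists_hasCoeffDerivAt hLd hPL
    (fun n => hpos.mono fun s hs => hsign n s t hs ht)
  obtain ⟨n, rfl⟩ : ∃ m, n = m + 1 := ⟨n - 1, by omega⟩
  have hdt (x : ℝ) : dtP P (n + 1) x t = (Q (n + 1)).eval x := ((hQ (n + 1)).eval x).deriv
  have hda : deriv (fun s => leadCoeff P (n + 1) s) t = (Q (n + 1)).coeff (n + 1) :=
    ((hQ (n + 1)).coeff (n + 1)).deriv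
  have hA : recA P (n + 1) t = (P n t).coeff n / (P (n + 1) t).coeff (n + 1) := rfl
  have hl : leadCoeff P (n + 1) t = (P (n + 1) t).coeff (n + 1) := rfl
  have hc := hPt.apply_taylor_one_mul n
  simp only [Nat.add_sub_cancel, hdt, hda, hA, hl, Nat.cast_add, Nat.cast_one]
  refine ⟨fun m => ((hQ (n + 1)).coeff m).differentiableAt, ?_, ?_, ?_, ?_, fun x => ?_⟩
  · have h := hL t ht (Q (n + 1) * mulXShift (P n t))
    rw [apply_deriv_mul_mulXShift hLd hLX hQ hPL] at h
    simpa only [eval_mul, eval_mulXShift] using h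
  · obtain ⟨c, hc⟩ := exists_expansion hPt.degree_eq (n + 2) (taylor 1 (P (n + 1) t))
      (by rw [degree_taylor]; exact hPt.degree_lt (Nat.lt_succ_self _))
    exact ⟨c, (comp_X_add_one _).trans hc⟩
  · intro c h
    have e : taylor 1 (P (n + 1) t) = _ := (comp_X_add_one _).symm.trans h
    rw [← hc]
    simp only [e]
    rw [hPt.apply_sum_mul, if_pos (by omega)]
  · have h := hL t ht (taylor 1 (P (n + 1) t) * P n t)
    rw [hc] at h
    simpa only [eval_mul, taylor_eval] using h
  -- The Christoffel–Darboux kernel with `x` frozen, as a polynomial in the other variable; pairing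
  -- with it gives a convergent series even where k - 1 = x.
  · set K := ∑ j ∈ Finset.range n, C ((P j t).eval x) * P j t with hK
    have hcd (y : ℝ) : recA P n t * cdQuotient (P n t) (prevPoly P n t) x y = K.eval y := by
      rw [recA_mul_cdQuotient hPt, hK]
      simp [eval_finsetSum]
    have h := hL t ht (Q (n + 1) * mulXShift K)
    simp only [eval_mul, eval_mulXShift, ← hcd] at h
    have hcongr (k : ℕ) : (Q (n + 1)).eval (k : ℝ) * (k * (recA P n t *
        cdQuotient (P n t) (prevPoly P n t) x (k - 1))) * weight ν lam t k =
        recA P n t * ((Q (n + 1)).eval (k : ℝ) * (k * weight ν lam t k) *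
          cdQuotient (P n t) (prevPoly P n t) x (k - 1)) := by ring
    simp only [hcongr] at h
    constructor
    -- For index 0 the factor A_0 = 0 cannot be divided out, but the quotient itself vanishes
    -- because P_{-1} = 0.
    · rcases n with _ | n
      · simp [cdQuotient, prevPoly]
      · refine (summable_mul_left_iff ?_).1 h.summable
        exact div_ne_zero (hPt.coeff_ne_zero n) (hPt.coeff_ne_zero (n + 1))
    · rw [forwardDiff, taylor_sub_eq_deriv hLd hLX hQ hPL hlam0.ne' n x, ← hK, ← h.tsum_eq,
        tsum_mul_left]
      ring
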